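/- Let $\Delta\ge 1$ and $q\ge 2\Delta$ be integers, and let $G$ be a finite simple graph with vertex set $V$, $n=|V|$, and maximum degree at most $\Delta$. For $\vec\lambda=(\lambda_1,\dots,\lambda_q)\in\mathbb C^q$ let $$Z_G(\vec\lambda)=\sum_{\substack{\sigma:V\to\{1,\dots,q\}\\ \sigma \text{ proper}}}\ \prod_{i=1}^q\lambda_i^{|\sigma^{-1}(i)|}$$ be the multivariate coloring partition function, where $\sigma$ is proper if $\sigma(u)\ne\sigma(v)$ for every edge $uv$ of $G$. Put $\nu=0.9$ and $\epsilon_I=10^{-4}\Delta^{-4}$, let $\ln$ be the principal branch of the logarithm and $\arg=\Im\ln$. Call $\vec\lambda$ valid if for all $i,j\in\{1,\dots,q\}$: 1. $\lambda_i\notin(-\infty,0]$; 2. $|\arg\lambda_i|\le\nu\epsilon_I/2$; 3. $|\Re\ln(\lambda_i/\lambda_j)|\le\Delta\epsilon_I$. If $\vec\lambda$ is valid, then $Z_G(\vec\lambda)\ne0$, and moreover $$|Z_G(\vec\lambda)|\ \ge\ 0.99^{\,n}\left(\frac{\lambda_{\min}}{\lambda_{\max}}\right)^{n\Delta},$$ where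 $\lambda_{\min}=\min\{1,\min_i|\lambda_i|\}$ and $\lambda_{\max}=\max\{1,\max_i|\lambda_i|\}$. -/

import Mathlib

namespace ColoringModel

/-- The multivariate coloring partition function `Z_G(λ₁, …, λ_q)`: the sum over all proper
`q`-colorings `σ` of `∏ i, λ i ^ |σ⁻¹(i)|`. -/
noncomputable def partitionFunction {V : Type*} [Fintype V] (G : SimpleGraph V) {q : ℕ}
    (lam : Fin q → ℂ) : ℂ :=
  open Classical in
  ∑ σ : V → Fin q with (∀ u v, G.Adj u v → σ u ≠ σ v),
    ∏ i : Fin q, lam i ^ (Finset.univ.filter (fun v => σ v = i)).card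

/-- The constant `ν = 0.9`. -/
noncomputable def nu : ℝ := 0.9

/-- The constant `ε_I = 10⁻⁴ Δ⁻⁴`. -/
noncomputable def epsI (Δ : ℕ) : ℝ := 1 / (10 ^ 4 * (Δ : ℝ) ^ 4)

/-- Validity of a fugacity vector. `Complex.slitPlane` is the complement of `(-∞, 0]` in `ℂ`;
`Complex.arg` and `Complex.log` are the principal branches. -/
structure Valid (Δ : ℕ) {q : ℕ} (lam : Fin q → ℂ) : Prop where
  mem_slitPlane : ∀ i, lam i ∈ Complex.slitPlane
  abs_arg_le : ∀ i, |(lam i).arg| ≤ nu * epsI Δ / 2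
  abs_re_log_div_le : ∀ i j, |(Complex.log (lam i / lam j)).re| ≤ Δ * epsI Δ

/-- `λ_min = min {1, min_i |λ_i|}` (meaningful for `q ≥ 1`). -/
noncomputable def lamMin {q : ℕ} (lam : Fin q → ℂ) : ℝ := min 1 (⨅ i, ‖lam i‖)

/-- `λ_max = max {1, max_i |λ_i|}` (meaningful for `q ≥ 1`). -/
noncomputable def lamMax {q : ℕ} (lam : Fin q → ℂ) : ℝ := max 1 (⨆ i, ‖lam i‖)

end ColoringModel

/-! ### Estimates for complex numbers with close logarithms. -/

namespace ColoringModel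

/-! The argument is an induction on the number of vertices, over list colorings in which every
vertex has at least K = Δ more colors than uncolored neighbors. Normalize the weighted sum by the
number of list colorings. For a vertex v, let Y_c be λ_c times the normalized sum left after v
receives c. If the logarithms of the Y_c are close, Z is a sum of nearly parallel vectors and cannot
cancel (`norm_listZ_cons_ge`).

To compare colors i and j at v, the lists of its neighbors are switched one by one from lacking j to
lacking i. At a neighbor u this compares two weighted averages of the Y_c belonging to u, one
omitting i and one omitting j. Each color of u carries at most 1/K of the uniform mass of the others
(`mul_listZ_one_delColor_le`), so a spread D at u shrinks to about D/K (`exists_exp_ratio`). Apart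
from v, u has at most K - 1 neighbors, hence D = (K - 1)A + b, where A bounds the effect of one
neighbor and b the logarithmic spread of λ. With A = 4Δε and b = 2Δε the shrunken spread is again at
most A (`contraction_bound`), which closes the induction `listZ_lower_bound_and_logClose`. -/

lemma norm_exp_mul_sub_le {η y : ℂ} {D : ℝ} (hη : ‖η‖ ≤ D) (hD : D ≤ 1) :
    ‖Complex.exp η * y - y‖ ≤ (D + D ^ 2) * ‖y‖ := by
  have h1 : ‖Complex.exp η - 1‖ ≤ D + D ^ 2 := by
    have h2 := Complex.norm_exp_sub_one_sub_id_le (hη.trans hD)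
    calc ‖Complex.exp η - 1‖ = ‖(Complex.exp η - 1 - η) + η‖ := by ring_nf
      _ ≤ ‖η‖ ^ 2 + ‖η‖ := (norm_add_le _ _).trans (by gcongr)
      _ ≤ D ^ 2 + D := by gcongr
      _ = D + D ^ 2 := add_comm _ _
  calc ‖Complex.exp η * y - y‖ = ‖Complex.exp η - 1‖ * ‖y‖ := by
        rw [← norm_mul]; ring_nf
    _ ≤ _ := by gcongr

/-- If two scalars in `[0, κ]` multiply vectors that have length at most `M` and are at distance
at most `M`, then the products are at distance at most `κ * M`. -/
lemma norm_smul_sub_smul_le {x y : ℂ} {M κ v w : ℝ} (hx : ‖x‖ ≤ M) (hy : ‖y‖ ≤ M)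
    (hxy : ‖x - y‖ ≤ M) (hv : 0 ≤ v) (hw : 0 ≤ w) (hvκ : v ≤ κ) (hwκ : w ≤ κ) :
    ‖(v : ℂ) * x - w * y‖ ≤ κ * M := by
  have key : ∀ {x y : ℂ} {v w : ℝ}, ‖y‖ ≤ M → ‖x - y‖ ≤ M → 0 ≤ v → v ≤ w → w ≤ κ →
      ‖(v : ℂ) * x - w * y‖ ≤ κ * M := by
    intro x y v w hy hxy hv hvw hw
    have hM : 0 ≤ M := (norm_nonneg _).trans hy
    calc ‖(v : ℂ) * x - w * y‖ = ‖(v : ℂ) * (x - y) - ((w - v : ℝ) : ℂ) * y‖ := by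
          push_cast; ring_nf
      _ ≤ ‖(v : ℂ) * (x - y)‖ + ‖((w - v : ℝ) : ℂ) * y‖ := norm_sub_le _ _
      _ = v * ‖x - y‖ + (w - v) * ‖y‖ := by
          rw [norm_mul, norm_mul, Complex.norm_of_nonneg hv,
            Complex.norm_of_nonneg (sub_nonneg.2 hvw)]
      _ ≤ v * M + (w - v) * M := by
          have := sub_nonneg.2 hvw
          gcongr
      _ = w * M := by ring
      _ ≤ κ * M := by gcongr
  rcases le_total v w with h | h
  · exact key hy hxy hv h hwκ
  · rw [norm_sub_rev]
    exact key hx (by rwa [norm_sub_rev]) hw h hvκ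

/-- Closeness is recorded by some exponent η instead of a logarithm of x / y, so that errors add
along a chain without any choice of branch. -/
lemma exists_exp_mul_of_norm_sub_le {x y : ℂ} {r : ℝ} (hr : r ≤ 1 / 2) (hy : y ≠ 0)
    (hxy : ‖x - y‖ ≤ r * ‖y‖) :
    ∃ η : ℂ, ‖η‖ ≤ r + r ^ 2 ∧ x = Complex.exp η * y := by
  have hy' : 0 < ‖y‖ := norm_pos_iff.2 hy
  have hξ : ‖(x - y) / y‖ ≤ r := by rwa [norm_div, div_le_iff₀ hy']
  set ξ := (x - y) / y with hdef
  have hr0 : 0 ≤ r := (norm_nonneg _).trans hξ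
  have hξ1 : ‖ξ‖ < 1 := by linarith
  refine ⟨Complex.log (1 + ξ), ?_, ?_⟩
  · refine (Complex.norm_log_one_add_le hξ1).trans ?_
    have h1 : (1 - ‖ξ‖)⁻¹ ≤ 2 := by
      rw [inv_le_comm₀ (by linarith) (by norm_num)]
      linarith
    have h2 : ‖ξ‖ ^ 2 * (1 - ‖ξ‖)⁻¹ / 2 ≤ ‖ξ‖ ^ 2 * 2 / 2 := by gcongr
    have h3 : ‖ξ‖ ^ 2 ≤ r ^ 2 := by gcongr
    linarith
  · have hne : 1 + ξ ≠ 0 := by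
      intro h
      have : ξ = -1 := by linear_combination h
      rw [this] at hξ1
      simp at hξ1
    rw [Complex.exp_log hne, hdef]
    field_simp
    ring

/-! ### Contraction for weighted averages. -/

section
variable {C : Type*} [DecidableEq C]

/-- Both quotients are averages of Y_c = a_c / b_c. If S is the average over all of s, omitting k
gives S - w(Y_k - S) with 0 ≤ w ≤ κ. Since Y_i - S, Y_j - S and also Y_i - Y_j have size about D‖S‖,
the two corrections differ by about κD‖S‖. The triangle inequality alone would give 2κD‖S‖, too much
for the contraction when K ≥ 2. -/
lemma exists_exp_ratio {s : Finset C} {b : C → ℝ} {a : C → ℂ} {κ D : ℝ}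
    (hb : ∀ c ∈ s, 0 < b c) (ha : ∀ c ∈ s, a c ≠ 0) (hκ0 : 0 ≤ κ) (hκ : κ ≤ 1)
    (hD0 : 0 ≤ D) (hD : D ≤ 1 / 1000)
    (hab : ∀ c ∈ s, ∀ d ∈ s, ∃ η : ℂ, ‖η‖ ≤ D ∧ a c / b c = Complex.exp η * (a d / b d))
    {i j : C} (hi0 : (s.erase i).Nonempty) (hj0 : (s.erase j).Nonempty)
    (hi : i ∈ s → b i ≤ κ * ∑ c ∈ s.erase i, b c)
    (hj : j ∈ s → b j ≤ κ * ∑ c ∈ s.erase j, b c) :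
    ∃ η : ℂ, ‖η‖ ≤ κ * D * (1 + 10 * D) ∧
      (∑ c ∈ s.erase i, a c) / ((∑ c ∈ s.erase i, b c : ℝ) : ℂ) =
        Complex.exp η * ((∑ c ∈ s.erase j, a c) / ((∑ c ∈ s.erase j, b c : ℝ) : ℂ)) := by
  obtain ⟨c₀, hc₀'⟩ := hi0
  have hc₀ : c₀ ∈ s := Finset.mem_of_mem_erase hc₀'
  set B : ℝ := ∑ c ∈ s, b c with hB
  have hBpos : 0 < B := Finset.sum_pos hb ⟨c₀, hc₀⟩
  have hBne : (B : ℂ) ≠ 0 := by exact_mod_cast hBpos.ne'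
  set S : ℂ := (∑ c ∈ s, a c) / B with hS
  set Y : C → ℂ := fun c => a c / b c with hY
  have hbY : ∀ c ∈ s, a c = b c * Y c := by
    intro c hc
    have : (b c : ℂ) ≠ 0 := by exact_mod_cast (hb c hc).ne'
    simp only [hY]
    field_simp
  have hYne : ∀ c ∈ s, Y c ≠ 0 := by
    intro c hc h
    exact ha c hc (by rw [hbY c hc, h, mul_zero])
  have hYY : ∀ c ∈ s, ∀ d ∈ s, ‖Y c - Y d‖ ≤ (D + D ^ 2) * ‖Y d‖ := by
    intro c hc d hd
    obtain ⟨η, hη, h⟩ := hab c hc d hd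
    change Y c = Complex.exp η * Y d at h
    rw [h]
    exact norm_exp_mul_sub_le hη (by linarith)
  have hSY : ∀ d ∈ s, ‖Y d - S‖ ≤ (D + D ^ 2) * ‖Y d‖ := by
    intro d hd
    have h1 : (B : ℂ) * (S - Y d) = ∑ c ∈ s, (b c : ℂ) * (Y c - Y d) := by
      simp only [mul_sub, Finset.sum_sub_distrib, ← Finset.sum_mul]
      rw [hS, mul_div_cancel₀ _ hBne, Finset.sum_congr rfl hbY, hB]
      push_cast
      rfl
    have h2 : B * ‖S - Y d‖ ≤ B * ((D + D ^ 2) * ‖Y d‖) := by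
      calc B * ‖S - Y d‖ = ‖(B : ℂ) * (S - Y d)‖ := by
            rw [norm_mul, Complex.norm_of_nonneg hBpos.le]
        _ ≤ ∑ c ∈ s, b c * ((D + D ^ 2) * ‖Y d‖) := by
            rw [h1]
            refine norm_sum_le_of_le _ fun c hc => ?_
            rw [norm_mul, Complex.norm_of_nonneg (hb c hc).le]
            exact mul_le_mul_of_nonneg_left (hYY c hc d hd) (hb c hc).le
        _ = _ := by rw [← Finset.sum_mul]
    rw [norm_sub_rev]
    exact le_of_mul_le_mul_left h2 hBpos
  have hD2 : D ^ 2 ≤ D / 1000 := by nlinarith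
  -- Turns a bound relative to ‖Y d‖ into one relative to ‖S‖: solving for y gives y ≤ (1 +
  -- 3D/2)‖S‖, and (1 + D)(1 + 3D/2) ≤ 1 + 3D.
  have hD'' : ∀ y : ℝ, y ≤ ‖S‖ + (D + D ^ 2) * y → 0 ≤ y →
      (D + D ^ 2) * y ≤ D * (1 + 3 * D) * ‖S‖ := by
    intro y hy hy0
    have h1 : y ≤ (1 + 3 / 2 * D) * ‖S‖ := by
      have h3 : (1 - (D + D ^ 2)) * y ≤ ‖S‖ := by linarith
      have h4 : 1 ≤ (1 + 3 / 2 * D) * (1 - (D + D ^ 2)) := by nlinarith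
      calc y = 1 * y := (one_mul y).symm
        _ ≤ ((1 + 3 / 2 * D) * (1 - (D + D ^ 2))) * y := by gcongr
        _ = (1 + 3 / 2 * D) * ((1 - (D + D ^ 2)) * y) := by ring
        _ ≤ _ := by gcongr
    calc (D + D ^ 2) * y ≤ (D + D ^ 2) * ((1 + 3 / 2 * D) * ‖S‖) := by gcongr
      _ = (D * ((1 + D) * (1 + 3 / 2 * D))) * ‖S‖ := by ring
      _ ≤ _ := by
        have : (1 + D) * (1 + 3 / 2 * D) ≤ 1 + 3 * D := by nlinarith
        gcongr
  set M : ℝ := D * (1 + 3 * D) * ‖S‖ with hM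
  have hYM : ∀ d ∈ s, (D + D ^ 2) * ‖Y d‖ ≤ M := by
    intro d hd
    refine hD'' _ ?_ (norm_nonneg _)
    have := norm_sub_norm_le (Y d) S
    linarith [hSY d hd]
  have hSne : S ≠ 0 := by
    intro h
    have h1 := hSY c₀ hc₀
    rw [h, sub_zero] at h1
    have h2 : 0 < ‖Y c₀‖ := norm_pos_iff.2 (hYne c₀ hc₀)
    nlinarith
  have hE : ∀ k : C, (s.erase k).Nonempty → (k ∈ s → b k ≤ κ * ∑ c ∈ s.erase k, b c) →
      ∃ c ∈ s, ∃ w : ℝ, 0 ≤ w ∧ w ≤ κ ∧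
        (∑ c ∈ s.erase k, a c) / ((∑ c ∈ s.erase k, b c : ℝ) : ℂ) = S - w * (Y c - S) := by
    intro k hk0 hk
    have hpos : 0 < ∑ c ∈ s.erase k, b c :=
      Finset.sum_pos (fun c hc => hb c (Finset.mem_of_mem_erase hc)) hk0
    by_cases hks : k ∈ s
    · refine ⟨k, hks, b k / ∑ c ∈ s.erase k, b c, div_nonneg (hb k hks).le hpos.le,
        (div_le_iff₀ hpos).2 (hk hks), ?_⟩
      have e1 : ∑ c ∈ s.erase k, a c = B * S - b k * Y k := by
        rw [← hbY k hks, hS, mul_div_cancel₀ _ hBne, ← Finset.add_sum_erase s a hks]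
        ring
      have e2 : (B : ℂ) = b k + ((∑ c ∈ s.erase k, b c : ℝ) : ℂ) := by
        rw [hB, ← Finset.add_sum_erase s b hks]
        push_cast
        rfl
      have hne : ((∑ c ∈ s.erase k, b c : ℝ) : ℂ) ≠ 0 := by exact_mod_cast hpos.ne'
      rw [e1, e2, Complex.ofReal_div]
      field_simp
      ring
    -- Nothing is omitted here; the weight 0 makes the color c₀ irrelevant.
    · refine ⟨c₀, hc₀, 0, le_rfl, hκ0, ?_⟩
      rw [Finset.erase_eq_of_notMem hks]
      simp [hS, hB]
  obtain ⟨c, hc, v, hv0, hvκ, hEi⟩ := hE i ⟨c₀, hc₀'⟩ hi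
  obtain ⟨d, hd, w, hw0, hwκ, hEj⟩ := hE j hj0 hj
  rw [hEi, hEj]
  have hSpos : 0 < ‖S‖ := norm_pos_iff.2 hSne
  have hM0 : 0 ≤ M := by positivity
  have hdiff : ‖(S - v * (Y c - S)) - (S - w * (Y d - S))‖ ≤ κ * M := by
    have := norm_smul_sub_smul_le (κ := κ) ((hSY c hc).trans (hYM c hc))
      ((hSY d hd).trans (hYM d hd))
      (by rw [sub_sub_sub_cancel_right]; exact (hYY c hc d hd).trans (hYM d hd)) hv0 hw0 hvκ hwκ
    have e : (S - v * (Y c - S)) - (S - w * (Y d - S)) =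
        -((v : ℂ) * (Y c - S) - w * (Y d - S)) := by ring
    rwa [e, norm_neg]
  have hlow : (1 - D * (1 + 3 * D)) * ‖S‖ ≤ ‖S - w * (Y d - S)‖ := by
    have h1 : ‖(w : ℂ) * (Y d - S)‖ ≤ 1 * M := by
      rw [norm_mul, Complex.norm_of_nonneg hw0]
      have := (hSY d hd).trans (hYM d hd)
      gcongr
      exact hwκ.trans hκ
    have h2 := norm_sub_norm_le S ((w : ℂ) * (Y d - S))
    rw [hM] at h1
    linarith
  have hsmall : D * (1 + 3 * D) ≤ 1 / 2 := by nlinarith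
  have hne : S - w * (Y d - S) ≠ 0 := by
    intro h
    rw [h, norm_zero] at hlow
    nlinarith
  -- Dividing by the lower bound `hlow` raises 1 + 3D to 1 + 5D; passing to the logarithm below
  -- raises it to 1 + 10D.
  have hκM : κ * M ≤ κ * (D * (1 + 5 * D)) * ‖S - w * (Y d - S)‖ := by
    calc κ * M = κ * D * ((1 + 3 * D) * ‖S‖) := by rw [hM]; ring
      _ ≤ κ * D * ((1 + 5 * D) * ((1 - D * (1 + 3 * D)) * ‖S‖)) := by
          have : 1 + 3 * D ≤ (1 + 5 * D) * (1 - D * (1 + 3 * D)) := by nlinarith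
          rw [← mul_assoc (1 + 5 * D)]
          gcongr
      _ ≤ κ * D * ((1 + 5 * D) * ‖S - w * (Y d - S)‖) := by gcongr
      _ = _ := by ring
  have hr : κ * (D * (1 + 5 * D)) ≤ D * (1 + 5 * D) := by
    have : 0 ≤ D * (1 + 5 * D) := by positivity
    nlinarith
  obtain ⟨η, hη, h⟩ := exists_exp_mul_of_norm_sub_le (r := κ * (D * (1 + 5 * D)))
    (hr.trans (by nlinarith)) hne (hdiff.trans hκM)
  refine ⟨η, hη.trans ?_, h⟩
  calc κ * (D * (1 + 5 * D)) + (κ * (D * (1 + 5 * D))) ^ 2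
      = κ * (D * (1 + 5 * D)) * (1 + κ * (D * (1 + 5 * D))) := by ring
    _ ≤ κ * (D * (1 + 5 * D)) * (1 + D * (1 + 5 * D)) := by gcongr
    _ = κ * D * ((1 + 5 * D) * (1 + D * (1 + 5 * D))) := by ring
    _ ≤ κ * D * (1 + 10 * D) := by
        have : (1 + 5 * D) * (1 + D * (1 + 5 * D)) ≤ 1 + 10 * D := by nlinarith
        gcongr

end
-- List colorings: vertex recursion and uniform marginals.
section
open Classical
variable {V C R : Type*} [CommSemiring R]

/-- Remove the color `c` from the lists of all neighbors of `v`. -/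
noncomputable def delColor (G : SimpleGraph V) (v : V) (c : C) (L : V → Finset C) : V → Finset C :=
  fun w => if G.Adj v w then (L w).erase c else L w

/-- The list-coloring partition function of the subgraph induced on the vertices in a list. -/
noncomputable def listZ (G : SimpleGraph V) (lam : C → R) : List V → (V → Finset C) → R
  | [], _ => 1
  | v :: l, L => ∑ c ∈ L v, lam c * listZ G lam l (delColor G v c L)

/-- The number of neighbors of `v` in a list of vertices. -/
noncomputable def listDeg (G : SimpleGraph V) (l : List V) (v : V) : ℕ :=
  l.countP (fun w => G.Adj v w)

/-- Every vertex has at least `K` more colors than neighbors. -/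
def Feasible (G : SimpleGraph V) (K : ℕ) (l : List V) (L : V → Finset C) : Prop :=
  ∀ v ∈ l, listDeg G l v + K ≤ (L v).card

variable {G : SimpleGraph V} {lam : C → R}

lemma delColor_congr {v w : V} {c : C} {L L' : V → Finset C} (h : L w = L' w) :
    delColor G v c L w = delColor G v c L' w := by
  simp only [delColor, h]

lemma delColor_comm (u v : V) (c d : C) (L : V → Finset C) :
    delColor G u c (delColor G v d L) = delColor G v d (delColor G u c L) := by
  funext w
  simp only [delColor]
  split_ifs
  · exact Finset.erase_right_comm
  all_goals rfl

lemma delColor_update {u w : V} (c : C) (L : V → Finset C) (T : Finset C) :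
    delColor G w c (Function.update L u T) =
      Function.update (delColor G w c L) u (if G.Adj w u then T.erase c else T) := by
  funext x
  by_cases hx : x = u
  · subst hx; simp [delColor]
  · simp [delColor, hx]

lemma listZ_congr {l : List V} : ∀ {L L' : V → Finset C}, (∀ w ∈ l, L w = L' w) →
    listZ G lam l L = listZ G lam l L' := by
  induction l with
  | nil => intros; rfl
  | cons v l ih =>
    intro L L' h
    simp only [listZ]
    rw [h v List.mem_cons_self]
    exact Finset.sum_congr rfl fun c _ => by
      rw [ih fun w hw => delColor_congr (h w (List.mem_cons_of_mem _ hw))]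

lemma listZ_cons_update {u : V} {l : List V} (hu : u ∉ l) (L : V → Finset C) (T : Finset C) :
    listZ G lam (u :: l) (Function.update L u T) =
      ∑ c ∈ T, lam c * listZ G lam l (delColor G u c L) := by
  simp only [listZ, Function.update_self]
  refine Finset.sum_congr rfl fun c _ => ?_
  rw [listZ_congr fun w hw => delColor_congr (Function.update_of_ne (ne_of_mem_of_not_mem hw hu) T L)]

/-- Both sides sum over the same pairs of colors, distinct if u and v are adjacent. Order
independence allows the recursion to be opened at any chosen neighbor. -/
lemma listZ_swap (u v : V) (l : List V) (L : V → Finset C) :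
    listZ G lam (u :: v :: l) L = listZ G lam (v :: u :: l) L := by
  simp only [listZ, Finset.mul_sum]
  rw [Finset.sum_comm' (s' := fun d => delColor G v d L u) (t' := L v)]
  · refine Finset.sum_congr rfl fun d _ => Finset.sum_congr rfl fun c _ => ?_
    rw [delColor_comm, mul_left_comm]
  · intro c d
    simp only [delColor, G.adj_comm v u]
    split_ifs
    · simp only [Finset.mem_erase]
      tauto
    · rfl

lemma listZ_perm {l l' : List V} (h : l.Perm l') :
    ∀ L : V → Finset C, listZ G lam l L = listZ G lam l' L := by
  induction h with
  | nil => intro; rfl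
  | cons v _ ih =>
    intro L
    simp only [listZ, ih]
  | swap u v l => exact fun L => listZ_swap v u l L
  | trans _ _ ih₁ ih₂ => exact fun L => (ih₁ L).trans (ih₂ L)

lemma listDeg_perm {l l' : List V} (h : l.Perm l') (v : V) : listDeg G l v = listDeg G l' v :=
  h.countP_eq _

lemma listDeg_cons_of_adj {u v : V} (h : G.Adj u v) (l : List V) :
    listDeg G (u :: l) v = listDeg G l v + 1 := by
  simp [listDeg, h.symm]

lemma listDeg_cons_of_not_adj {u v : V} (h : ¬ G.Adj u v) (l : List V) :
    listDeg G (u :: l) v = listDeg G l v := by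
  simp [listDeg, G.adj_comm v u, h]

lemma listDeg_cons_self (v : V) (l : List V) : listDeg G (v :: l) v = listDeg G l v :=
  listDeg_cons_of_not_adj (by simp) l

lemma Feasible.perm {K : ℕ} {l l' : List V} {L : V → Finset C} (h : Feasible G K l L)
    (hp : l.Perm l') : Feasible G K l' L := by
  intro v hv
  rw [← listDeg_perm hp]
  exact h v (hp.mem_iff.2 hv)

/-- A neighbor of v loses one from its degree, which pays for one lost color. The lists L' are
general so that the mixed lists between two colors of v are covered. -/
lemma Feasible.of_cons {K : ℕ} {v : V} {l : List V} {L L' : V → Finset C}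
    (h : Feasible G K (v :: l) L) (h1 : ∀ w ∈ l, ¬ G.Adj v w → L' w = L w)
    (h2 : ∀ w ∈ l, G.Adj v w → (L w).card ≤ (L' w).card + 1) : Feasible G K l L' := by
  intro w hw
  have h3 := h w (List.mem_cons_of_mem _ hw)
  by_cases ha : G.Adj v w
  · rw [listDeg_cons_of_adj ha] at h3
    have := h2 w hw ha
    omega
  · rw [listDeg_cons_of_not_adj ha] at h3
    rwa [h1 w hw ha]

lemma card_le_card_erase_add_one (s : Finset C) (c : C) : s.card ≤ (s.erase c).card + 1 := by
  have := Finset.pred_card_le_card_erase (s := s) (a := c)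
  omega

lemma Feasible.delColor {K : ℕ} {v : V} {l : List V} {L : V → Finset C}
    (h : Feasible G K (v :: l) L) (c : C) : Feasible G K l (delColor G v c L) := by
  refine h.of_cons (fun w _ hw => by simp [ColoringModel.delColor, hw]) fun w _ hw => ?_
  simpa [ColoringModel.delColor, hw] using card_le_card_erase_add_one (L w) c

lemma Feasible.listZ_one_pos {K : ℕ} (hK : 1 ≤ K) {l : List V} {L : V → Finset C}
    (h : Feasible G K l L) : 0 < listZ G (fun _ => (1 : ℝ)) l L := by
  induction l generalizing L with
  | nil => simp [listZ]
  | cons v l ih =>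
    simp only [listZ, one_mul]
    refine Finset.sum_pos (fun c _ => ih (h.delColor c)) (Finset.card_pos.1 ?_)
    have := h v List.mem_cons_self
    omega

/-- With u colored last, each neighbor has removed at most one of its colors, so K remain, against
at most one from T. T is not required to be a singleton because its color may itself be removed
along the way. -/
lemma mul_listZ_one_update_le_append {K : ℕ} {u : V} (l : List V) (hu : u ∉ l) {L : V → Finset C}
    (hL : listDeg G l u + K ≤ (L u).card) {T : Finset C} (hT : T.card ≤ 1) :
    K * listZ G (fun _ => (1 : ℝ)) (l ++ [u]) (Function.update L u T) ≤
      listZ G (fun _ => (1 : ℝ)) (l ++ [u]) L := by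
  induction l generalizing L T with
  | nil =>
    simp only [List.nil_append, listZ, Function.update_self, Finset.sum_const,
      nsmul_eq_mul, mul_one]
    have h1 : K * T.card ≤ (L u).card := by
      calc K * T.card ≤ K * 1 := Nat.mul_le_mul_left _ hT
        _ ≤ _ := by omega
    exact_mod_cast h1
  | cons w l ih =>
    have hwu : w ≠ u := fun h => hu (h ▸ List.mem_cons_self)
    have hul : u ∉ l := fun h => hu (List.mem_cons_of_mem _ h)
    simp only [List.cons_append, listZ, one_mul, Function.update_of_ne hwu, Finset.mul_sum]
    refine Finset.sum_le_sum fun c _ => ?_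
    rw [delColor_update]
    refine ih hul ?_ ?_
    · by_cases ha : G.Adj w u
      · rw [listDeg_cons_of_adj ha] at hL
        have := card_le_card_erase_add_one (L u) c
        simp only [delColor, ha, if_true]
        omega
      · rw [listDeg_cons_of_not_adj ha] at hL
        simpa [delColor, ha] using hL
    · split_ifs
      · exact (Finset.card_erase_le).trans hT
      · exact hT

/-- In a uniform random list coloring, u has color i with probability at most 1/K. -/
lemma mul_listZ_one_delColor_le {K : ℕ} {u : V} {l : List V} (hu : u ∉ l) {L : V → Finset C}
    (hL : listDeg G l u + K ≤ (L u).card) (i : C) :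
    K * listZ G (fun _ => (1 : ℝ)) l (delColor G u i L) ≤
      ∑ c ∈ L u, listZ G (fun _ => (1 : ℝ)) l (delColor G u c L) := by
  have hp : (l ++ [u]).Perm (u :: l) := List.perm_append_singleton u l
  have h := mul_listZ_one_update_le_append l hu hL (T := {i}) (by simp)
  rw [listZ_perm hp, listZ_perm hp, listZ_cons_update hu] at h
  simpa [listZ] using h

end
-- Closeness of ratios and the induction.
section
open Classical
variable {V C : Type*} {G : SimpleGraph V} {lam : C → ℂ}

/-- The ratio of the list-coloring partition function to the number of list colorings. -/
noncomputable def listRatio (G : SimpleGraph V) (lam : C → ℂ) (l : List V) (L : V → Finset C) : ℂ :=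
  listZ G lam l L / ((listZ G (fun _ => (1 : ℝ)) l L : ℝ) : ℂ)

lemma listRatio_congr {l : List V} {L L' : V → Finset C} (h : ∀ w ∈ l, L w = L' w) :
    listRatio G lam l L = listRatio G lam l L' := by
  simp only [listRatio, listZ_congr h]

lemma listRatio_perm {l l' : List V} (h : l.Perm l') (L : V → Finset C) :
    listRatio G lam l L = listRatio G lam l' L := by
  simp only [listRatio, listZ_perm h]

lemma listRatio_cons_update {u : V} {l : List V} (hu : u ∉ l) (L : V → Finset C) (T : Finset C) :
    listRatio G lam (u :: l) (Function.update L u T) =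
      (∑ c ∈ T, lam c * listZ G lam l (delColor G u c L)) /
        ((∑ c ∈ T, listZ G (fun _ => (1 : ℝ)) l (delColor G u c L) : ℝ) : ℂ) := by
  simp only [listRatio, listZ_cons_update hu, one_mul]

/-- The ratios obtained by fixing the color of `v` have logarithms at distance at most `D`. -/
def LogClose (G : SimpleGraph V) (lam : C → ℂ) (D : ℝ) (v : V) (l : List V)
    (L : V → Finset C) : Prop :=
  ∀ i ∈ L v, ∀ j ∈ L v, ∃ η : ℂ, ‖η‖ ≤ D ∧
    lam i * listRatio G lam l (delColor G v i L) =
      Complex.exp η * (lam j * listRatio G lam l (delColor G v j L))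

/-- Contraction at a single neighbor `u`: removing `i` or `j` from the list of `u`. -/
lemma exists_exp_listRatio_update {K : ℕ} (hK : 1 ≤ K) {D : ℝ} (hD0 : 0 ≤ D) (hD : D ≤ 1 / 1000)
    {u : V} {l : List V} (hu : u ∉ l) {L : V → Finset C} (hL : Feasible G K (u :: l) L)
    (hLu : listDeg G l u + (K + 1) ≤ (L u).card)
    (hZ : ∀ c ∈ L u, lam c * listZ G lam l (delColor G u c L) ≠ 0)
    (hclose : LogClose G lam D u l L) (i j : C) :
    ∃ η : ℂ, ‖η‖ ≤ (1 / K : ℝ) * D * (1 + 10 * D) ∧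
      listRatio G lam (u :: l) (Function.update L u ((L u).erase i)) =
        Complex.exp η * listRatio G lam (u :: l) (Function.update L u ((L u).erase j)) := by
  have hK' : (1 : ℝ) ≤ K := by exact_mod_cast hK
  have hK0 : (0 : ℝ) < K := by linarith
  rw [listRatio_cons_update hu, listRatio_cons_update hu]
  have hne : ∀ k : C, ((L u).erase k).Nonempty := by
    intro k
    have := card_le_card_erase_add_one (L u) k
    exact Finset.card_pos.1 (by omega)
  have hmarg : ∀ k : C, k ∈ L u → listZ G (fun _ => (1 : ℝ)) l (delColor G u k L) ≤
      (1 / K : ℝ) * ∑ c ∈ (L u).erase k, listZ G (fun _ => (1 : ℝ)) l (delColor G u c L) := by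
    intro k hk
    -- The marginal bound holds with K + 1; splitting off the term of k itself leaves K against the
    -- remaining colors.
    have h := mul_listZ_one_delColor_le hu hLu k
    rw [← Finset.add_sum_erase _ _ hk] at h
    rw [one_div_mul_eq_div, le_div_iff₀ hK0]
    push_cast at h
    linarith
  refine exists_exp_ratio (fun c _ => (hL.delColor c).listZ_one_pos hK) hZ (by positivity)
    ((div_le_one hK0).2 hK') hD0 hD ?_ (hne i) (hne j) (hmarg i) (hmarg j)
  intro c hc d hd
  obtain ⟨η, hη, h⟩ := hclose c hc d hd
  refine ⟨η, hη, ?_⟩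
  simpa only [listRatio, mul_div_assoc] using h

/-- The lists in which the neighbors of `v` in `t` lose `i` and its other neighbors lose `j`. -/
noncomputable def mixColor (G : SimpleGraph V) (v : V) (i j : C) (t : List V)
    (L : V → Finset C) : V → Finset C :=
  fun w => if G.Adj v w then (L w).erase (if w ∈ t then i else j) else L w

lemma mixColor_nil (v : V) (i j : C) (L : V → Finset C) :
    mixColor G v i j [] L = delColor G v j L := by
  funext w
  simp [mixColor, delColor]

/-- The logarithmic distance caused by recoloring `v`, if every neighbor contributes `A`. -/
lemma exists_exp_listRatio_mixColor {A : ℝ} {v : V} {l : List V} {L : V → Finset C} {i j : C}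
    (hstep : ∀ u ∈ l, G.Adj v u → ∀ L' : V → Finset C, (∀ w, ¬ G.Adj v w → L' w = L w) →
      (∀ w, G.Adj v w → (L w).card ≤ (L' w).card + 1) → L' u = L u →
      ∃ η : ℂ, ‖η‖ ≤ A ∧ listRatio G lam l (Function.update L' u ((L' u).erase i)) =
        Complex.exp η * listRatio G lam l (Function.update L' u ((L' u).erase j)))
    (t : List V) (ht : t.Nodup) (htl : ∀ w ∈ t, w ∈ l) :
    ∃ η : ℂ, ‖η‖ ≤ listDeg G t v * A ∧ listRatio G lam l (mixColor G v i j t L) =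
      Complex.exp η * listRatio G lam l (delColor G v j L) := by
  induction t with
  | nil => exact ⟨0, by simp [listDeg], by simp [mixColor_nil]⟩
  | cons u t ih =>
    obtain ⟨hut, ht'⟩ := List.nodup_cons.1 ht
    obtain ⟨η, hη, h⟩ := ih ht' fun w hw => htl w (List.mem_cons_of_mem _ hw)
    by_cases ha : G.Adj v u
    -- The step is used on the mixed lists with the full list restored at u: erasing i gives the
    -- mixed lists for `u :: t`, erasing j those for t, as u ∉ t.
    · have hu1 : ∀ w, ¬ G.Adj v w → Function.update (mixColor G v i j t L) u (L u) w = L w := by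
        intro w hw
        rw [Function.update_of_ne (by rintro rfl; exact hw ha)]
        simp [mixColor, hw]
      have hu2 : ∀ w, G.Adj v w →
          (L w).card ≤ (Function.update (mixColor G v i j t L) u (L u) w).card + 1 := by
        intro w hw
        by_cases hwu : w = u
        · subst hwu; simp
        · rw [Function.update_of_ne hwu]
          simpa [mixColor, hw] using card_le_card_erase_add_one (L w) _
      obtain ⟨ζ, hζ, h'⟩ := hstep u (htl u List.mem_cons_self) ha
        (Function.update (mixColor G v i j t L) u (L u)) hu1 hu2 (Function.update_self ..)
      simp only [Function.update_self, Function.update_idem] at h'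
      have e1 : Function.update (mixColor G v i j t L) u ((L u).erase i) =
          mixColor G v i j (u :: t) L := by
        funext w
        by_cases hw : w = u
        · subst hw; simp [mixColor, ha]
        · simp [mixColor, hw]
      have e2 : Function.update (mixColor G v i j t L) u ((L u).erase j) =
          mixColor G v i j t L := by
        funext w
        by_cases hw : w = u
        · subst hw; simp [mixColor, ha, hut]
        · simp [hw]
      rw [e1, e2, h, ← mul_assoc, ← Complex.exp_add] at h'
      refine ⟨ζ + η, (norm_add_le _ _).trans ?_, h'⟩
      have : listDeg G (u :: t) v = listDeg G t v + 1 := by simp [listDeg, ha]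
      rw [this]
      push_cast
      linarith
    · refine ⟨η, ?_, ?_⟩
      · have : listDeg G (u :: t) v = listDeg G t v := by simp [listDeg, ha]
        rwa [this]
      · rw [← h]
        congr 1
        funext w
        by_cases hw : G.Adj v w
        · have : w ≠ u := by rintro rfl; exact ha hw
          simp [mixColor, this]
        · simp [mixColor, hw]

lemma mixColor_self (v : V) (i j : C) (l : List V) (L : V → Finset C) :
    listRatio G lam l (mixColor G v i j l L) = listRatio G lam l (delColor G v i L) := by
  refine listRatio_congr fun w hw => ?_
  simp [mixColor, delColor, hw]

/-- The sum is ∑ b_c Y_c with b_c > 0 and every Y_c within one percent of Y_i, so its norm is at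
least 0.99 (∑ b_c)‖Y_i‖; keeping only b_i gives the claim. -/
lemma norm_listZ_cons_ge {K : ℕ} (hK : 1 ≤ K) {D : ℝ} (hD : D + D ^ 2 ≤ 1 / 100) (hD1 : D ≤ 1)
    {v : V} {l : List V} {L : V → Finset C} (hL : Feasible G K (v :: l) L)
    (hclose : LogClose G lam D v l L) {i : C} (hi : i ∈ L v) :
    0.99 * (‖lam i‖ * ‖listZ G lam l (delColor G v i L)‖) ≤ ‖listZ G lam (v :: l) L‖ := by
  set b : C → ℝ := fun c => listZ G (fun _ => (1 : ℝ)) l (delColor G v c L) with hb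
  have hbpos : ∀ c, 0 < b c := fun c => (hL.delColor c).listZ_one_pos hK
  set Y : C → ℂ := fun c => lam c * listRatio G lam l (delColor G v c L) with hY
  have hbY : ∀ c, lam c * listZ G lam l (delColor G v c L) = b c * Y c := by
    intro c
    have : (b c : ℂ) ≠ 0 := by exact_mod_cast (hbpos c).ne'
    simp only [hY, listRatio]
    change _ = (b c : ℂ) * (lam c * (_ / (b c : ℂ)))
    field_simp
  set B : ℝ := ∑ c ∈ L v, b c with hB
  have hbB : b i ≤ B := Finset.single_le_sum (fun c _ => (hbpos c).le) hi
  have hdiff : ‖(B : ℂ) * Y i - listZ G lam (v :: l) L‖ ≤ B * (1 / 100 * ‖Y i‖) := by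
    have e : (B : ℂ) * Y i - listZ G lam (v :: l) L = ∑ c ∈ L v, (b c : ℂ) * (Y i - Y c) := by
      simp only [listZ, hbY, mul_sub, Finset.sum_sub_distrib, ← Finset.sum_mul, hB]
      push_cast
      rfl
    rw [e, hB, Finset.sum_mul]
    refine norm_sum_le_of_le _ fun c hc => ?_
    rw [norm_mul, Complex.norm_of_nonneg (hbpos c).le, norm_sub_rev]
    refine mul_le_mul_of_nonneg_left ?_ (hbpos c).le
    obtain ⟨η, hη, h⟩ := hclose c hc i hi
    change Y c = Complex.exp η * Y i at h
    rw [h]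
    exact (norm_exp_mul_sub_le hη hD1).trans (by gcongr)
  have h1 := norm_sub_norm_le ((B : ℂ) * Y i) (listZ G lam (v :: l) L)
  rw [norm_mul, Complex.norm_of_nonneg ((hbpos i).le.trans hbB)] at h1
  have h2 : ‖lam i‖ * ‖listZ G lam l (delColor G v i L)‖ = b i * ‖Y i‖ := by
    rw [← norm_mul, hbY, norm_mul, Complex.norm_of_nonneg (hbpos i).le]
  rw [h2]
  have h3 : b i * ‖Y i‖ ≤ B * ‖Y i‖ := by gcongr
  linarith

/-- Zero-freeness and closeness of the color ratios, by induction on the number of vertices. -/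
theorem listZ_lower_bound_and_logClose {K : ℕ} (hK : 1 ≤ K) {A b m : ℝ} (hA : 0 ≤ A) (hb : 0 ≤ b)
    (hm : 0 < m) (hlam : ∀ c, m ≤ ‖lam c‖)
    (hlog : ∀ i j, ∃ η : ℂ, ‖η‖ ≤ b ∧ lam i = Complex.exp η * lam j)
    (hsmall : K * A + b ≤ 1 / 1000)
    (hcontr : (1 / K : ℝ) * ((K - 1) * A + b) * (1 + 10 * ((K - 1) * A + b)) ≤ A)
    (n : ℕ) : ∀ (l : List V) (L : V → Finset C), l.length = n → l.Nodup →
      (∀ v ∈ l, listDeg G l v ≤ K) → Feasible G K l L →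
      (0.99 * m) ^ n ≤ ‖listZ G lam l L‖ ∧
        ∀ v l', l = v :: l' → LogClose G lam (b + listDeg G l' v * A) v l' L := by
  have hK' : (1 : ℝ) ≤ K := by exact_mod_cast hK
  have hlam0 : ∀ c, lam c ≠ 0 := fun c => norm_pos_iff.1 (hm.trans_le (hlam c))
  induction n using Nat.strong_induction_on with
  | _ n ih =>
  rcases n with _ | n
  · intro l L hl _ _ _
    obtain rfl := List.length_eq_zero_iff.1 hl
    simp [listZ]
  · intro l L hl hnd hdeg hL
    obtain ⟨v, l, rfl⟩ := List.exists_cons_of_length_eq_add_one hl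
    have hln : l.length = n := by simpa using hl
    obtain ⟨hvl, hnd'⟩ := List.nodup_cons.1 hnd
    have hdeg' : ∀ w ∈ l, listDeg G l w ≤ K := fun w hw =>
      (List.Sublist.countP_le (List.sublist_cons_self v l)).trans
        (hdeg w (List.mem_cons_of_mem _ hw))
    have hclose : LogClose G lam (b + listDeg G l v * A) v l L := by
      intro i hi j hj
      obtain ⟨ζ, hζ, hlij⟩ := hlog i j
      have hstep : ∀ u ∈ l, G.Adj v u → ∀ L' : V → Finset C, (∀ w, ¬ G.Adj v w → L' w = L w) →
          (∀ w, G.Adj v w → (L w).card ≤ (L' w).card + 1) → L' u = L u →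
          ∃ η : ℂ, ‖η‖ ≤ A ∧ listRatio G lam l (Function.update L' u ((L' u).erase i)) =
            Complex.exp η * listRatio G lam l (Function.update L' u ((L' u).erase j)) := by
        intro u hu ha L' h1 h2 hLu
        have hL' : Feasible G K l L' := hL.of_cons (fun w _ => h1 w) fun w _ => h2 w
        have hp : l.Perm (u :: l.erase u) := List.perm_cons_erase hu
        rw [listRatio_perm hp, listRatio_perm hp]
        have hndu : (u :: l.erase u).Nodup := hp.nodup_iff.1 hnd'
        have hfu := hL'.perm hp
        have hlen : (l.erase u).length + 1 = n := by rw [← hln, hp.length_eq]; simp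
        have hdegu : ∀ w ∈ u :: l.erase u, listDeg G (u :: l.erase u) w ≤ K := fun w hw => by
          rw [← listDeg_perm hp]
          exact hdeg' w (hp.mem_iff.2 hw)
        have hul := (List.nodup_cons.1 hndu).1
        -- The absence of v is what counts: it leaves u with degree at most K - 1, whence the value
        -- of D, and with one color more than feasibility demands.
        have hdu : listDeg G (v :: l) u = listDeg G (l.erase u) u + 1 := by
          rw [listDeg_cons_of_adj ha, listDeg_perm hp, listDeg_cons_self]
        have hcardu := hL u (List.mem_cons_of_mem _ hu)
        have hdu' := hdeg u (List.mem_cons_of_mem _ hu)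
        rw [hdu] at hcardu hdu'
        have hc := (ih n n.lt_succ_self (u :: l.erase u) L' (by simpa using hlen) hndu hdegu
          hfu).2 u _ rfl
        set D : ℝ := (K - 1) * A + b with hD
        have hD0 : 0 ≤ D := by
          have : 0 ≤ (K : ℝ) - 1 := by linarith
          positivity
        have hDle : b + listDeg G (l.erase u) u * A ≤ D := by
          have : (listDeg G (l.erase u) u : ℝ) + 1 ≤ K := by exact_mod_cast hdu'
          nlinarith
        have hc' : LogClose G lam D u (l.erase u) L' := fun c hc1 d hd1 => by
          obtain ⟨η, hη, h⟩ := hc c hc1 d hd1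
          exact ⟨η, hη.trans hDle, h⟩
        -- Nonvanishing is needed with both v and u removed, two vertices down, hence the strong
        -- induction.
        have hZ : ∀ c ∈ L' u, lam c * listZ G lam (l.erase u)
            (ColoringModel.delColor G u c L') ≠ 0 := by
          intro c hc1
          refine mul_ne_zero (hlam0 c) ?_
          have hlt : (l.erase u).length < n + 1 := by omega
          have h3 := (ih _ hlt (l.erase u) (ColoringModel.delColor G u c L') rfl
            (List.nodup_cons.1 hndu).2 (fun w hw =>
              (List.Sublist.countP_le (List.sublist_cons_self u (l.erase u))).trans
                (hdegu w (List.mem_cons_of_mem _ hw))) (hfu.delColor c)).1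
          have h4 : 0 < (0.99 * m) ^ (l.erase u).length := by positivity
          exact norm_pos_iff.1 (h4.trans_le h3)
        obtain ⟨η, hη, h⟩ := exists_exp_listRatio_update hK hD0 (by linarith) hul hfu
          (by rw [hLu]; omega) hZ hc' i j
        exact ⟨η, hη.trans hcontr, h⟩
      obtain ⟨η, hη, h⟩ := exists_exp_listRatio_mixColor hstep l hnd' fun w hw => hw
      rw [mixColor_self] at h
      refine ⟨ζ + η, (norm_add_le _ _).trans (add_le_add hζ hη), ?_⟩
      rw [h, hlij, Complex.exp_add]
      ring
    refine ⟨?_, ?_⟩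
    · have hv := hL v List.mem_cons_self
      obtain ⟨i, hi⟩ : (L v).Nonempty := Finset.card_pos.1 (by omega)
      have h1 : (listDeg G l v : ℝ) ≤ K := by
        rw [← listDeg_cons_self]
        exact_mod_cast hdeg v List.mem_cons_self
      have h2 : b + listDeg G l v * A ≤ 1 / 1000 := by
        refine le_trans ?_ hsmall
        rw [add_comm]
        gcongr
      have h0 : 0 ≤ b + listDeg G l v * A := by positivity
      have h3 := norm_listZ_cons_ge hK (by nlinarith) (by linarith) hL hclose hi
      have h4 := (ih n n.lt_succ_self l (delColor G v i L) hln hnd' hdeg' (hL.delColor i)).1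
      refine le_trans ?_ h3
      rw [pow_succ']
      calc 0.99 * m * (0.99 * m) ^ n = 0.99 * (m * (0.99 * m) ^ n) := by ring
        _ ≤ _ := by
          gcongr
          exact hlam i
    · rintro v' l' h
      obtain ⟨rfl, rfl⟩ := List.cons.inj h
      exact hclose
end
-- The recursion as a sum over proper colorings.
section
open Classical
variable {V C R : Type*} [CommSemiring R] {G : SimpleGraph V} {lam : C → R}

/-- The proper list colorings of the vertices in `l`, extended by `c₀` outside of `l`. -/
def IsListColoring (G : SimpleGraph V) (c₀ : C) (l : List V) (L : V → Finset C) (σ : V → C) :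
    Prop :=
  (∀ v ∈ l, σ v ∈ L v) ∧ (∀ u ∈ l, ∀ v ∈ l, G.Adj u v → σ u ≠ σ v) ∧ ∀ v ∉ l, σ v = c₀

lemma IsListColoring.tail {c₀ : C} {v : V} {l : List V} (hv : v ∉ l) {L : V → Finset C} {σ : V → C}
    (h : IsListColoring G c₀ (v :: l) L σ) :
    IsListColoring G c₀ l (delColor G v (σ v) L) (Function.update σ v c₀) := by
  obtain ⟨h1, h2, h3⟩ := h
  have hne : ∀ w ∈ l, w ≠ v := fun w hw => ne_of_mem_of_not_mem hw hv
  refine ⟨fun w hw => ?_, fun u hu w hw => ?_, fun w hw => ?_⟩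
  · rw [Function.update_of_ne (hne w hw)]
    have := h1 w (List.mem_cons_of_mem _ hw)
    simp only [delColor]
    split_ifs with ha
    · exact Finset.mem_erase.2
        ⟨(h2 v List.mem_cons_self w (List.mem_cons_of_mem _ hw) ha).symm, this⟩
    · exact this
  · rw [Function.update_of_ne (hne u hu), Function.update_of_ne (hne w hw)]
    exact h2 u (List.mem_cons_of_mem _ hu) w (List.mem_cons_of_mem _ hw)
  · by_cases hwv : w = v
    · subst hwv; simp
    · rw [Function.update_of_ne hwv]
      exact h3 w (by simp [hwv, hw])

lemma IsListColoring.cons {c₀ c : C} {v : V} {l : List V} (hv : v ∉ l) {L : V → Finset C}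
    {σ : V → C} (hc : c ∈ L v) (h : IsListColoring G c₀ l (delColor G v c L) σ) :
    IsListColoring G c₀ (v :: l) L (Function.update σ v c) := by
  obtain ⟨h1, h2, h3⟩ := h
  have hne : ∀ w ∈ l, w ≠ v := fun w hw => ne_of_mem_of_not_mem hw hv
  have hadj : ∀ w ∈ l, G.Adj v w → σ w ≠ c := fun w hw ha => by
    have := h1 w hw
    simp only [delColor, ha, if_true, Finset.mem_erase] at this
    exact this.1
  refine ⟨fun w hw => ?_, fun u hu' w hw' ha => ?_, fun w hw => ?_⟩
  · rcases List.mem_cons.1 hw with rfl | hw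
    · simpa using hc
    · rw [Function.update_of_ne (hne w hw)]
      have := h1 w hw
      simp only [delColor] at this
      split_ifs at this
      · exact Finset.mem_of_mem_erase this
      · exact this
  · rcases List.mem_cons.1 hu' with rfl | hu <;> rcases List.mem_cons.1 hw' with rfl | hw
    · exact absurd ha (G.loopless.irrefl _)
    · rw [Function.update_self, Function.update_of_ne (hne w hw)]
      exact (hadj w hw ha).symm
    · rw [Function.update_self, Function.update_of_ne (hne u hu)]
      exact hadj u hu ha.symm
    · rw [Function.update_of_ne (hne u hu), Function.update_of_ne (hne w hw)]
      exact h2 u hu w hw ha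
  · rw [List.mem_cons, not_or] at hw
    rw [Function.update_of_ne hw.1]
    exact h3 w hw.2

/-- A coloring σ of `v :: l` corresponds to σ v together with σ reset to c₀ at v. Fixing the value
c₀ off the list makes this a bijection between total functions. -/
lemma listZ_eq_sum [Fintype V] [Fintype C] (c₀ : C) {l : List V} (hl : l.Nodup)
    (L : V → Finset C) :
    listZ G lam l L = ∑ σ : V → C with IsListColoring G c₀ l L σ,
      (l.map fun v => lam (σ v)).prod := by
  induction l generalizing L with
  | nil =>
    have : (Finset.univ.filter fun σ : V → C => IsListColoring G c₀ [] L σ) = {fun _ => c₀} := by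
      ext σ
      simp [IsListColoring, funext_iff]
    rw [this]
    simp [listZ]
  | cons v l ih =>
    obtain ⟨hv, hl'⟩ := List.nodup_cons.1 hl
    have hne : ∀ w ∈ l, w ≠ v := fun w hw => ne_of_mem_of_not_mem hw hv
    simp only [listZ, ih hl', Finset.mul_sum]
    rw [Finset.sum_sigma']
    refine Finset.sum_bij' (fun x _ => Function.update x.2 v x.1)
      (fun σ _ => ⟨σ v, Function.update σ v c₀⟩) ?_ ?_ ?_ ?_ ?_
    · rintro ⟨c, σ⟩ h
      simp only [Finset.mem_sigma, Finset.mem_filter, Finset.mem_univ, true_and] at h ⊢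
      exact h.2.cons hv h.1
    · intro σ h
      simp only [Finset.mem_sigma, Finset.mem_filter, Finset.mem_univ, true_and] at h ⊢
      exact ⟨h.1 v List.mem_cons_self, h.tail hv⟩
    · rintro ⟨c, σ⟩ h
      simp only [Finset.mem_sigma, Finset.mem_filter, Finset.mem_univ, true_and] at h
      have : c₀ = σ v := (h.2.2.2 v hv).symm
      simp [this]
    · intro σ _
      simp
    · rintro ⟨c, σ⟩ _
      simp only [List.map_cons, List.prod_cons, Function.update_self]
      congr 2
      exact List.map_congr_left fun w hw => by rw [Function.update_of_ne (hne w hw)]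

end

lemma partitionFunction_eq_listZ {V : Type*} [Fintype V] (G : SimpleGraph V) {q : ℕ} (hq : 0 < q)
    (lam : Fin q → ℂ) :
    partitionFunction G lam =
      listZ G lam (Finset.univ : Finset V).toList (fun _ => Finset.univ) := by
  classical
  rw [listZ_eq_sum ⟨0, hq⟩ (Finset.nodup_toList _), partitionFunction]
  refine Finset.sum_congr ?_ fun σ _ => ?_
  · ext σ
    simp [IsListColoring]
  · rw [Finset.prod_map_toList, ← Finset.prod_fiberwise_of_maps_to (t := Finset.univ) (g := σ)
      (fun _ _ => Finset.mem_univ _)]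
    refine Finset.prod_congr rfl fun i _ => ?_
    have h : ∀ v ∈ Finset.univ.filter (fun v => σ v = i), lam (σ v) = lam i := fun v hv => by
      rw [(Finset.mem_filter.1 hv).2]
    rw [Finset.prod_congr rfl h, Finset.prod_const]


/-! ### Validity, the choice of constants, and the conclusion. -/

lemma Valid.exists_exp {Δ q : ℕ} (hΔ : 1 ≤ Δ) {lam : Fin q → ℂ} (h : Valid Δ lam) (i j : Fin q) :
    ∃ η : ℂ, ‖η‖ ≤ 2 * Δ * epsI Δ ∧ lam i = Complex.exp η * lam j := by
  have hi := Complex.slitPlane_ne_zero (h.mem_slitPlane i)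
  have hj := Complex.slitPlane_ne_zero (h.mem_slitPlane j)
  have hΔ' : (1 : ℝ) ≤ Δ := by exact_mod_cast hΔ
  have heps : 0 ≤ epsI Δ := by unfold epsI; positivity
  refine ⟨Complex.log (lam i) - Complex.log (lam j), ?_, ?_⟩
  · refine (Complex.norm_le_abs_re_add_abs_im _).trans ?_
    have hre : |(Complex.log (lam i) - Complex.log (lam j)).re| ≤ Δ * epsI Δ := by
      have h1 := h.abs_re_log_div_le i j
      rw [Complex.log_re, norm_div, Real.log_div (norm_ne_zero_iff.2 hi) (norm_ne_zero_iff.2 hj)]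
        at h1
      rwa [Complex.sub_re, Complex.log_re, Complex.log_re]
    -- Two arguments of size at most νε/2 contribute at most ε, as ν < 1. Since ε ≤ Δε, the real and
    -- imaginary parts together give 2Δε.
    have him : |(Complex.log (lam i) - Complex.log (lam j)).im| ≤ 1 * epsI Δ := by
      rw [Complex.sub_im, Complex.log_im, Complex.log_im]
      refine (abs_sub _ _).trans ?_
      have h1 := h.abs_arg_le i
      have h2 := h.abs_arg_le j
      unfold nu at h1 h2
      linarith
    have : 1 * epsI Δ ≤ Δ * epsI Δ := by gcongr
    linarith
  · rw [Complex.exp_sub, Complex.exp_log hi, Complex.exp_log hj, div_mul_cancel₀ _ hj]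

/-- Here x = Δ, b = 2xe and A = 4xe, so D/x = (4x - 2)e falls short of A by 2e. This gap absorbs the
factor 1 + 10D, whose excess is at most 160x³e · e. -/
lemma contraction_bound {x e : ℝ} (hx : 1 ≤ x) (he0 : 0 ≤ e) (he : x ^ 3 * e ≤ 1 / 10 ^ 4) :
    1 / x * ((x - 1) * (4 * x * e) + 2 * x * e) *
      (1 + 10 * ((x - 1) * (4 * x * e) + 2 * x * e)) ≤ 4 * x * e := by
  have h1 : 1 / x * ((x - 1) * (4 * x * e) + 2 * x * e) = (4 * x - 2) * e := by
    field_simp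
    ring
  have h2 : (x - 1) * (4 * x * e) + 2 * x * e ≤ 4 * (x ^ 2 * e) := by nlinarith
  have h3 : 0 ≤ x ^ 2 * e := by positivity
  have h4 : (4 * x - 2) * (1 + 10 * ((x - 1) * (4 * x * e) + 2 * x * e)) ≤ 4 * x := calc
    _ ≤ (4 * x - 2) * (1 + 10 * (4 * (x ^ 2 * e))) := by
        have : 0 ≤ 4 * x - 2 := by linarith
        gcongr
    _ = 4 * x - 2 + 160 * (x ^ 3 * e) - 80 * (x ^ 2 * e) := by ring
    _ ≤ 4 * x := by linarith
  calc _ = (4 * x - 2) * (1 + 10 * ((x - 1) * (4 * x * e) + 2 * x * e)) * e := by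
        rw [h1]
        ring
    _ ≤ _ := by gcongr

theorem partitionFunction_lower_bound {V : Type*} [Fintype V] (G : SimpleGraph V) [DecidableRel G.Adj]
    (Δ q : ℕ) (hΔ : 1 ≤ Δ) (hq : 2 * Δ ≤ q) (hG : G.maxDegree ≤ Δ)
    (lam : Fin q → ℂ) (hlam : Valid Δ lam) :
    partitionFunction G lam ≠ 0 ∧
      (0.99 : ℝ) ^ Fintype.card V *
          (lamMin lam / lamMax lam) ^ (Fintype.card V * Δ) ≤
        ‖partitionFunction G lam‖ := by
  classical
  have hq0 : 0 < q := by omega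
  have : Nonempty (Fin q) := ⟨⟨0, hq0⟩⟩
  have hΔ' : (1 : ℝ) ≤ Δ := by exact_mod_cast hΔ
  have heps : 0 ≤ epsI Δ := by unfold epsI; positivity
  have heps2 : (Δ : ℝ) ^ 4 * epsI Δ = 1 / 10 ^ 4 := by
    unfold epsI
    field_simp
  have h3 : (Δ : ℝ) ^ 3 * epsI Δ ≤ 1 / 10 ^ 4 := by
    rw [← heps2]
    gcongr
    norm_num
  have h2 : (Δ : ℝ) ^ 2 * epsI Δ ≤ 1 / 10 ^ 4 := by
    rw [← heps2]
    gcongr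
    norm_num
  obtain ⟨i₀, hi₀⟩ := exists_eq_ciInf_of_finite (f := fun i => ‖lam i‖)
  set m : ℝ := ⨅ i, ‖lam i‖ with hm
  have hm0 : 0 < m := by
    rw [← hi₀]
    exact norm_pos_iff.2 (Complex.slitPlane_ne_zero (hlam.mem_slitPlane i₀))
  have hmle : ∀ i, m ≤ ‖lam i‖ := fun i => ciInf_le (Set.finite_range _).bddBelow i
  have hdeg : ∀ v, listDeg G (Finset.univ : Finset V).toList v ≤ Δ := by
    intro v
    refine le_trans (le_of_eq ?_) ((G.degree_le_maxDegree v).trans hG)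
    rw [listDeg, List.countP_eq_length_filter, ← SimpleGraph.card_neighborFinset_eq_degree]
    rw [← List.toFinset_card_of_nodup ((Finset.nodup_toList _).filter _)]
    congr 1
    ext w
    simp
  have hbound := (listZ_lower_bound_and_logClose (G := G) (lam := lam) hΔ (A := 4 * Δ * epsI Δ)
    (b := 2 * Δ * epsI Δ) (by positivity) (by positivity) hm0 hmle
    (hlam.exists_exp hΔ) (by nlinarith) (contraction_bound hΔ' heps h3) _
    (Finset.univ : Finset V).toList (fun _ => Finset.univ) rfl (Finset.nodup_toList _)
    -- Feasibility with K = Δ is where q ≥ 2Δ enters: degree plus Δ is at most 2Δ.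
    (fun v _ => hdeg v) (fun v _ => by
      have := hdeg v
      rw [Finset.card_univ, Fintype.card_fin]
      omega)).1
  rw [← partitionFunction_eq_listZ G hq0, Finset.length_toList, Finset.card_univ] at hbound
  refine ⟨norm_pos_iff.1 (lt_of_lt_of_le (by positivity) hbound), le_trans ?_ hbound⟩
  rw [mul_pow]
  gcongr
  have hmax1 : 1 ≤ lamMax lam := le_max_left _ _
  have hmin0 : 0 < lamMin lam := lt_min one_pos hm0
  have hmin1 : lamMin lam ≤ 1 := min_le_left _ _
  have hminm : lamMin lam ≤ m := min_le_right _ _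
  have hr : lamMin lam / lamMax lam ≤ lamMin lam := div_le_self hmin0.le hmax1
  have hr0 : 0 ≤ lamMin lam / lamMax lam := by positivity
  -- The induction gives the stronger bound (0.99 m)^n; the quotient is at most both 1 and m, so the
  -- exponent nΔ only weakens it.
  calc (lamMin lam / lamMax lam) ^ (Fintype.card V * Δ)
      ≤ (lamMin lam / lamMax lam) ^ (Fintype.card V) :=
        pow_le_pow_of_le_one hr0 (hr.trans hmin1) (Nat.le_mul_of_pos_right _ hΔ)
    _ ≤ m ^ Fintype.card V := by
        gcongr
        exact hr.trans hminm

end ColoringModel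

theorem mainTheorem1 {V : Type*} [Fintype V] (G : SimpleGraph V) [DecidableRel G.Adj]
    (Δ q : ℕ) (hΔ : 1 ≤ Δ) (hq : 2 * Δ ≤ q) (hG : G.maxDegree ≤ Δ)
    (lam : Fin q → ℂ) (hlam : ColoringModel.Valid Δ lam) :
    ColoringModel.partitionFunction G lam ≠ 0 ∧
      (0.99 : ℝ) ^ Fintype.card V *
          (ColoringModel.lamMin lam / ColoringModel.lamMax lam) ^ (Fintype.card V * Δ) ≤
        ‖ColoringModel.partitionFunction G lam‖ :=
  ColoringModel.partitionFunction_lower_bound G Δ q hΔ hq hG lam hlam
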